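/- **Theorem 2 (random vertex recovery).** *Model.* Let $V=\{1,\dots,n\}$. An adversary chooses $S\subseteq V$ with $|S|=k$. A random graph $G'=(V,E')$ is drawn in which each pair $\{u,v\}$ with $u\in S$, $v\notin S$ is an edge independently with probability $1/2$, and no other pair is an edge. Having seen $G'$, the adversary adds arbitrary edges $\{u,v\}$ that do not have both endpoints in $S$; the result is $G=(V,E)$. Finally a vertex $u_0$ is drawn uniformly from $S$, independently of $G'$ (and hence of $G$). *Algorithm.* The input is $(G,u_0)$; the algorithm knows neither $S$ nor $k$. 1. Take an optimal solution $(x_u)_{u\in V}$, $x_u\in\mathbb R^n$, of the crude SDP: minimize $\sum_{u,v\in V}\|x_u-x_v\|^2$ subject to $\|x_u\|^2=1$ for all $u$, $\langle x_u,x_v\rangle\ge 0$ for all $u,v$, and $\langle x_u,x_v\rangle=0$ for all $\{u,v\}\in E$. 2. For each $u\in V$ start with the set $\{v:\|x_v-x_u\|<1\}$ and extend it greedily: run through the vertices in increasing order, adding each vertex that is non-adjacent to all vertices already in the set. The list consists of the (distinct) sets so obtained that are independent in $G$. 3. Remove from the list all sets of size less than $n^{2/3}$. 4. Of the sets then on the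 list, remove every $S_1$ for which there is a set $S_2\neq S_1$ on the list with $|S_1\cap S_2|\ge\frac23|S_1|$. 5. For all sets $S_1\ne S_2$ then on the list with $|S_1\cap S_2|\ge 2\log_2 n$, remove both $S_1$ and $S_2$. 6. If $u_0$ lies in exactly one set that is still on the list, return this set; otherwise return FAIL. *Claim.* There is a constant $c_1>0$ such that, whenever $k\ge c_1n^{2/3}$, with high probability the algorithm returns exactly $S$. That is, for every $\delta>0$ there is an $N$ such that for all $n\ge N$, all $k\ge c_1n^{2/3}$, every $S\subseteq V$ with $|S|=k$, every strategy of the adversary for adding edges, and every choice of an optimal solution of the crude SDP in step 1, the probability over $G'$ and $u_0$ that the algorithm returns $S$ is at least $1-\delta$. -/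

import Mathlib

open MeasureTheory ProbabilityTheory

namespace SemirandomIndepSet

/-! ### The crude semidefinite program -/

/-- Assignments of a vector `x u ∈ ℝⁿ` to every vertex `u` of a graph on `n` vertices. -/
abbrev VectorAssignment (n : ℕ) : Type := Fin n → EuclideanSpace ℝ (Fin n)

/-- Feasibility for the crude SDP of `G`: unit vectors with pairwise non-negative inner products,
the vectors of adjacent vertices being orthogonal. -/
structure IsFeasible {n : ℕ} (G : SimpleGraph (Fin n)) (x : VectorAssignment n) : Prop where
  norm_sq_eq_one : ∀ u, ‖x u‖ ^ 2 = 1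
  inner_nonneg : ∀ u v, 0 ≤ inner ℝ (x u) (x v)
  inner_eq_zero : ∀ u v, G.Adj u v → inner ℝ (x u) (x v) = 0

/-- The objective of the crude SDP: the sum of `‖x u - x v‖²` over all ordered pairs. -/
noncomputable def objective {n : ℕ} (x : VectorAssignment n) : ℝ :=
  ∑ u, ∑ v, ‖x u - x v‖ ^ 2

/-- `x` is an optimal solution of the crude SDP of `G`. -/
structure IsOptimal {n : ℕ} (G : SimpleGraph (Fin n)) (x : VectorAssignment n) : Prop where
  feasible : IsFeasible G x
  objective_le : ∀ y, IsFeasible G y → objective x ≤ objective y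

/-- The crude SDP of every graph has an optimal solution. -/
theorem exists_isOptimal {n : ℕ} (G : SimpleGraph (Fin n)) : ∃ x, IsOptimal G x := by
  have hne : ∃ x, IsFeasible G x := by
    have hin : ∀ u v : Fin n, inner ℝ (EuclideanSpace.single u (1 : ℝ))
        (EuclideanSpace.single v (1 : ℝ)) = if u = v then (1 : ℝ) else 0 := fun u v => by
      simp [EuclideanSpace.inner_single_left]
    refine ⟨fun u => EuclideanSpace.single u 1, ⟨fun u => by simp, fun u v => ?_, fun u v h => ?_⟩⟩
    · rw [hin]; split_ifs <;> norm_num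
    · rw [hin, if_neg h.ne]
  have hcl : IsClosed {x : VectorAssignment n | IsFeasible G x} := by
    have : {x : VectorAssignment n | IsFeasible G x} =
        (⋂ u, {x | ‖x u‖ ^ 2 = 1}) ∩ ((⋂ u, ⋂ v, {x | 0 ≤ inner ℝ (x u) (x v)}) ∩
          (⋂ u, ⋂ v, ⋂ _ : G.Adj u v, {x | inner ℝ (x u) (x v) = 0})) := by
      ext x
      simp only [Set.mem_inter_iff, Set.mem_iInter, Set.mem_ofPred_eq]
      exact ⟨fun h => ⟨h.1, h.2, h.3⟩, fun h => ⟨h.1, h.2.1, h.2.2⟩⟩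
    rw [this]
    refine IsClosed.inter (isClosed_iInter fun u => ?_) (IsClosed.inter
      (isClosed_iInter fun u => isClosed_iInter fun v => ?_)
      (isClosed_iInter fun u => isClosed_iInter fun v => isClosed_iInter fun _ => ?_))
    · exact isClosed_eq (by fun_prop) (by fun_prop)
    · exact isClosed_le (by fun_prop) (by fun_prop)
    · exact isClosed_eq (by fun_prop) (by fun_prop)
  have hcomp : IsCompact {x : VectorAssignment n | IsFeasible G x} := by
    refine Metric.isCompact_of_isClosed_isBounded hcl
      (Metric.isBounded_closedBall (x := 0) (r := 1) |>.subset fun x hx => ?_)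
    rw [mem_closedBall_zero_iff, pi_norm_le_iff_of_nonneg zero_le_one]
    intro u
    have := hx.1 u
    nlinarith [norm_nonneg (x u)]
  have hcont : Continuous (objective (n := n)) := by
    unfold objective
    fun_prop
  obtain ⟨x, hx, hmin⟩ := hcomp.exists_isMinOn hne hcont.continuousOn
  exact ⟨x, hx, fun y hy => hmin hy⟩

/-! ### The candidate list -/

open scoped Classical in
/-- The vertices whose vectors are at distance less than `1` from the vector of `u`. -/
noncomputable def vertexBall {n : ℕ} (x : VectorAssignment n) (u : Fin n) : Finset (Fin n) :=
  Finset.univ.filter fun v => ‖x v - x u‖ < 1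

open scoped Classical in
/-- The greedy step: run through the vertices in increasing order, adding each vertex that is
non-adjacent to all vertices which are already in the set. -/
noncomputable def greedyExtend {n : ℕ} (G : SimpleGraph (Fin n)) (B : Finset (Fin n)) :
    Finset (Fin n) :=
  (List.finRange n).foldl (fun T v => if ∀ w ∈ T, ¬ G.Adj v w then insert v T else T) B

open scoped Classical in
/-- The candidate list: those greedily extended balls that are independent sets. -/
noncomputable def candidateList {n : ℕ} (G : SimpleGraph (Fin n)) (x : VectorAssignment n) :
    Finset (Finset (Fin n)) :=
  (Finset.univ.image fun u => greedyExtend G (vertexBall x u)).filter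
    fun T => G.IsIndepSet (T : Set (Fin n))

/-! ### Pruning -/

open scoped Classical in
/-- Remove the sets with fewer than `n ^ (2/3)` vertices. -/
noncomputable def removeSmall {n : ℕ} (L : Finset (Finset (Fin n))) : Finset (Finset (Fin n)) :=
  L.filter fun T => (n : ℝ) ^ (2 / 3 : ℝ) ≤ (T.card : ℝ)

open scoped Classical in
/-- Remove every set that shares at least two thirds of its vertices with another set of the
list. -/
noncomputable def removeMostlyCovered {n : ℕ} (L : Finset (Finset (Fin n))) :
    Finset (Finset (Fin n)) :=
  L.filter fun T => ∀ T' ∈ L, T ≠ T' → ((T ∩ T').card : ℝ) < 2 / 3 * (T.card : ℝ)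

open scoped Classical in
/-- Remove both members of every pair of distinct sets of the list that share at least
`2 log₂ n` vertices. -/
noncomputable def removeOverlapping {n : ℕ} (L : Finset (Finset (Fin n))) :
    Finset (Finset (Fin n)) :=
  L.filter fun T => ∀ T' ∈ L, T ≠ T' → ((T ∩ T').card : ℝ) < 2 * Real.logb 2 n

/-- The list which is left after the three removal steps. -/
noncomputable def prunedList {n : ℕ} (G : SimpleGraph (Fin n)) (x : VectorAssignment n) :
    Finset (Finset (Fin n)) :=
  removeOverlapping (removeMostlyCovered (removeSmall (candidateList G x)))

open scoped Classical in
/-- The output of the algorithm on the graph `G`, with `x` the solution found for the crude SDP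
of `G`, and on the given vertex `u`: the set on the pruned list that contains `u`, if there is
exactly one such set, and `none` (FAIL) otherwise. -/
noncomputable def recover {n : ℕ} (G : SimpleGraph (Fin n)) (x : VectorAssignment n)
    (u : Fin n) : Option (Finset (Fin n)) :=
  if h : ∃! T, T ∈ prunedList G x ∧ u ∈ T then some h.exists.choose else none

/-! ### The semi-random model -/

/-- The vertex pairs with one vertex in `S` and the other one outside `S`. -/
def boundary {n : ℕ} (S : Finset (Fin n)) : Set (Sym2 (Fin n)) :=
  {e | ∃ u ∈ S, ∃ v ∉ S, e = s(u, v)}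

/-- The probability `1/2`, as an element of the unit interval. -/
noncomputable def half : unitInterval := ⟨1 / 2, by norm_num, by norm_num⟩

/-- The law of the random graph `G'`: each pair of vertices with exactly one of them in `S` is an
edge with probability `1/2`, independently of the others, and no other pair is an edge. -/
noncomputable def randomGraph {n : ℕ} (S : Finset (Fin n)) : Measure (SimpleGraph (Fin n)) :=
  (setBernoulli (boundary S) half).map SimpleGraph.fromEdgeSet

/-- `A` is a strategy of the adversary: from a graph `H`, the adversary produces `A H` by adding
edges arbitrarily, except for pairs with both vertices in `S`. -/
def IsAdversary {n : ℕ} (S : Finset (Fin n))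
    (A : SimpleGraph (Fin n) → SimpleGraph (Fin n)) : Prop :=
  ∀ H, H ≤ A H ∧ ∀ u ∈ S, ∀ v ∈ S, (A H).Adj u v → H.Adj u v

/-- The joint law of the random graph `G'` and of an independent, uniformly random vertex
of `S`. -/
noncomputable def inputLaw {n : ℕ} (S : Finset (Fin n)) :
    Measure (SimpleGraph (Fin n) × Fin n) :=
  (randomGraph S).prod (uniformOn (S : Set (Fin n)))

end SemirandomIndepSet

/-!
Since `G` leaves `S` independent, replacing all vectors of `S` in an optimal solution by one unit
vector orthogonal to the other vectors stays feasible. Optimality therefore bounds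
`∑ u ∈ S, ∑ v ∈ S, ‖x u - x v‖ ^ 2` by a multiple of the inner products between `S` and its
complement. These vanish on edges, so weighting them by the `±1` matrix of the random pairs changes
nothing, and this matrix has operator norm `O(√n)`: their sum is `O(√n * √k * √n)`, a small fraction
of `k ^ 2` if `k` is a large multiple of `n ^ (2 / 3)`. Hence some vector of `S` is at distance at
most `1 / 2` from two thirds of `S`; every outside vertex has a neighbour among those, so it is
outside the ball around that vector, and the greedy extension of this ball is exactly `S`.

Any other set on the list is independent and contains an outside vertex, so it misses a third of
`S` and does not remove `S`. As no two sets of `2 log₂ n` vertices inside and outside `S` are free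
of edges, a set that meets `S` in `2 log₂ n` vertices has few vertices outside `S`, so `S` removes
it. Every other surviving set thus meets `S` in fewer than `2 log₂ n` vertices. By Cauchy-Schwarz at
most `2 n ^ (1 / 3)` sets survive, so only `4 n ^ (1 / 3) log₂ n = o(k)` vertices of `S` lie in a
second one.
-/

namespace SemirandomIndepSet

open Finset Real

section Greedy

variable {V : Type*} [DecidableEq V] {G : SimpleGraph V} {S B : Finset V}

open scoped Classical in
/-- One step of the greedy extension in `greedyExtend`: `v` joins `T` if it has no neighbour
there. -/
noncomputable def greedyStep (G : SimpleGraph V) (T : Finset V) (v : V) : Finset V :=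
  if ∀ w ∈ T, ¬ G.Adj v w then insert v T else T

theorem subset_greedyStep (T : Finset V) (v : V) : T ⊆ greedyStep G T v := by
  unfold greedyStep
  split_ifs
  exacts [subset_insert v T, subset_rfl]

theorem subset_foldl_greedyStep (l : List V) (B : Finset V) : B ⊆ l.foldl (greedyStep G) B := by
  induction l generalizing B with
  | nil => exact subset_rfl
  | cons a _ ih => exact (subset_greedyStep B a).trans (ih _)

theorem mem_foldl_greedyStep_or_exists_adj {l : List V} {v : V} (hv : v ∈ l) (B : Finset V) :
    v ∈ l.foldl (greedyStep G) B ∨ ∃ w ∈ l.foldl (greedyStep G) B, G.Adj v w := by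
  induction l generalizing B with
  | nil => exact absurd hv List.not_mem_nil
  | cons a l ih =>
    rcases List.mem_cons.1 hv with rfl | hv
    · have hsub := subset_foldl_greedyStep (G := G) l (greedyStep G B v)
      by_cases hB : ∀ w ∈ B, ¬ G.Adj v w
      · refine Or.inl (hsub ?_)
        rw [greedyStep, if_pos hB]
        exact mem_insert_self v B
      · push Not at hB
        obtain ⟨w, hw, hvw⟩ := hB
        exact Or.inr ⟨w, hsub (subset_greedyStep B v hw), hvw⟩
    · exact ih hv _

theorem foldl_greedyStep_subset (l : List V) (hBS : B ⊆ S) (hB : ∀ v ∉ S, ∃ w ∈ B, G.Adj v w) :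
    l.foldl (greedyStep G) B ⊆ S := by
  induction l generalizing B with
  | nil => exact hBS
  | cons a _ ih =>
    refine ih ?_ fun v hv => ?_
    · unfold greedyStep
      split_ifs with ha
      · refine insert_subset (by_contra fun haS => ?_) hBS
        obtain ⟨w, hw, haw⟩ := hB a haS
        exact ha w hw haw
      · exact hBS
    · obtain ⟨w, hw, hvw⟩ := hB v hv
      exact ⟨w, subset_greedyStep B a hw, hvw⟩

end Greedy

section GreedyExtend

variable {n : ℕ} {G : SimpleGraph (Fin n)} {S B : Finset (Fin n)}

theorem greedyExtend_eq_foldl (G : SimpleGraph (Fin n)) (B : Finset (Fin n)) :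
    greedyExtend G B = (List.finRange n).foldl (greedyStep G) B := by
  unfold greedyExtend greedyStep
  congr!

theorem greedyExtend_eq_of_subset (hS : G.IsIndepSet (S : Set (Fin n)))
    (h : greedyExtend G B ⊆ S) : greedyExtend G B = S := by
  rw [greedyExtend_eq_foldl] at h ⊢
  refine h.antisymm fun v hv => ?_
  rcases mem_foldl_greedyStep_or_exists_adj (G := G) (List.mem_finRange v) B with
    hmem | ⟨w, hw, hvw⟩
  · exact hmem
  · exact absurd hvw (hS hv (h hw) hvw.ne)

theorem greedyExtend_eq (hS : G.IsIndepSet (S : Set (Fin n))) (hBS : B ⊆ S)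
    (hB : ∀ v ∉ S, ∃ w ∈ B, G.Adj v w) : greedyExtend G B = S :=
  greedyExtend_eq_of_subset hS <|
    (greedyExtend_eq_foldl G B).trans_subset (foldl_greedyStep_subset _ hBS hB)

end GreedyExtend

section SmallIntersections

variable {α : Type*} [DecidableEq α] {L : Finset (Finset α)} {s l : ℝ}

theorem sum_card_filter_mem_sq [Fintype α] (L : Finset (Finset α)) :
    ∑ a, #{T ∈ L | a ∈ T} ^ 2 = ∑ T ∈ L, ∑ T' ∈ L, #(T ∩ T') := by
  calc ∑ a, #{T ∈ L | a ∈ T} ^ 2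
      = ∑ a, #{p ∈ L ×ˢ L | a ∈ p.1 ∩ p.2} := by
        simp only [sq, ← card_product, ← filter_product, mem_inter]
    _ = ∑ p ∈ L ×ˢ L, #{a | a ∈ p.1 ∩ p.2} :=
        sum_card_bipartiteAbove_eq_sum_card_bipartiteBelow _
    _ = ∑ T ∈ L, ∑ T' ∈ L, #(T ∩ T') := by
        simp only [filter_univ_mem, sum_product]

theorem sum_card_sq_le [Fintype α] (L : Finset (Finset α)) :
    (∑ T ∈ L, #T) ^ 2 ≤ Fintype.card α * ∑ T ∈ L, ∑ T' ∈ L, #(T ∩ T') := by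
  have hdouble : ∑ T ∈ L, #T = ∑ a, #{T ∈ L | a ∈ T} :=
    calc ∑ T ∈ L, #T = ∑ T ∈ L, #{a | a ∈ T} := by simp only [filter_univ_mem]
      _ = ∑ a, #{T ∈ L | a ∈ T} := (sum_card_bipartiteAbove_eq_sum_card_bipartiteBelow _).symm
  rw [hdouble, ← sum_card_filter_mem_sq]
  exact sq_sum_le_card_mul_sum_sq

theorem sum_card_inter_le (hl : 0 ≤ l)
    (hinter : ∀ T ∈ L, ∀ T' ∈ L, T ≠ T' → (#(T ∩ T') : ℝ) ≤ l) :
    ∑ T ∈ L, ∑ T' ∈ L, (#(T ∩ T') : ℝ) ≤ ∑ T ∈ L, (#T : ℝ) + #L ^ 2 * l := by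
  have hrow : ∀ T ∈ L, ∑ T' ∈ L, (#(T ∩ T') : ℝ) ≤ #T + #L * l := fun T hT =>
    calc ∑ T' ∈ L, (#(T ∩ T') : ℝ)
        = #T + ∑ T' ∈ L.erase T, (#(T ∩ T') : ℝ) := by
          rw [← add_sum_erase L _ hT, inter_self]
      _ ≤ #T + #(L.erase T) * l := by
          gcongr
          rw [← nsmul_eq_mul]
          exact sum_le_card_nsmul _ _ _ fun T' hT' =>
            hinter T hT T' (mem_of_mem_erase hT') (ne_of_mem_erase hT').symm
      _ ≤ #T + #L * l := by
          gcongr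
          exact erase_subset T L
  calc ∑ T ∈ L, ∑ T' ∈ L, (#(T ∩ T') : ℝ)
      ≤ ∑ T ∈ L, ((#T : ℝ) + #L * l) := sum_le_sum hrow
    _ = ∑ T ∈ L, (#T : ℝ) + #L ^ 2 * l := by
        rw [sum_add_distrib, sum_const, nsmul_eq_mul]
        ring

theorem card_mul_sq_le [Fintype α] (hs : 0 ≤ s) (hl : 0 ≤ l) (hcard : ∀ T ∈ L, s ≤ #T)
    (hinter : ∀ T ∈ L, ∀ T' ∈ L, T ≠ T' → (#(T ∩ T') : ℝ) ≤ l) :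
    #L * s ^ 2 ≤ Fintype.card α * (s + #L * l) := by
  set σ : ℝ := ∑ T ∈ L, (#T : ℝ) with hσ
  have hsum : #L * s ≤ σ := by
    rw [← nsmul_eq_mul]
    exact card_nsmul_le_sum _ _ _ hcard
  have hcs : σ ^ 2 ≤ Fintype.card α * (σ + #L ^ 2 * l) := by
    calc σ ^ 2 ≤ Fintype.card α * ∑ T ∈ L, ∑ T' ∈ L, (#(T ∩ T') : ℝ) := by
          rw [hσ]; exact_mod_cast sum_card_sq_le L
      _ ≤ Fintype.card α * (σ + #L ^ 2 * l) := by
          gcongr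
          exact sum_card_inter_le hl hinter
  rcases le_or_gt (#L * s) (Fintype.card α) with hle | hlt
  · have h : (#L * s) * s ≤ Fintype.card α * s := by gcongr
    have hnonneg : 0 ≤ (Fintype.card α : ℝ) * (#L * l) := by positivity
    linarith
  · have hL : (0 : ℝ) < #L := pos_of_mul_pos_left ((Nat.cast_nonneg _).trans_lt hlt) hs
    have hmono : #L * s * (#L * s - Fintype.card α) ≤ σ * (σ - Fintype.card α) :=
      mul_le_mul hsum (by linarith) (by linarith) (by linarith [hlt.le, hsum, hL])
    refine le_of_mul_le_mul_left ?_ hL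
    linarith

end SmallIntersections

section Pseudorandom

variable {V : Type*} {G H : SimpleGraph V} {S : Finset V} {t : ℝ}

/-- The properties of the random edges between `S` and its complement on which the recovery of `S`
rests: `S` is independent, every outside vertex sees every two thirds of `S`, and there is no
edgeless pair of sets of size at least `t`, one inside `S` and one outside. Adding edges that are
not inside `S` preserves them. -/
structure IsPseudorandom (G : SimpleGraph V) (S : Finset V) (t : ℝ) : Prop where
  isIndepSet : G.IsIndepSet (S : Set V)
  exists_adj : ∀ v ∉ S, ∀ T ⊆ S, 2 * #S ≤ 3 * #T → ∃ u ∈ T, G.Adj u v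
  exists_adj_of_le : ∀ A ⊆ S, ∀ B, Disjoint S B → t ≤ #A → t ≤ #B → ∃ a ∈ A, ∃ b ∈ B, G.Adj a b

theorem IsPseudorandom.of_le (h : IsPseudorandom H S t) (hHG : H ≤ G)
    (hS : ∀ u ∈ S, ∀ v ∈ S, G.Adj u v → H.Adj u v) : IsPseudorandom G S t where
  isIndepSet _ hu _ hv huv hadj := h.isIndepSet hu hv huv (hS _ hu _ hv hadj)
  exists_adj v hv T hT hcard :=
    let ⟨u, hu, huv⟩ := h.exists_adj v hv T hT hcard
    ⟨u, hu, hHG huv⟩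
  exists_adj_of_le A hA B hB hAt hBt :=
    let ⟨a, ha, b, hb, hab⟩ := h.exists_adj_of_le A hA B hB hAt hBt
    ⟨a, ha, b, hb, hHG hab⟩

variable [DecidableEq V] {T : Finset V}

theorem IsPseudorandom.card_inter_lt (h : IsPseudorandom G S t)
    (hT : G.IsIndepSet (T : Set V)) (hTS : ¬ T ⊆ S) : 3 * #(S ∩ T) < 2 * #S := by
  obtain ⟨v, hvT, hvS⟩ := not_subset.1 hTS
  by_contra! hcard
  obtain ⟨u, hu, huv⟩ := h.exists_adj v hvS (S ∩ T) inter_subset_left hcard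
  exact hT (mem_inter.1 hu).2 hvT huv.ne huv

theorem IsPseudorandom.card_sdiff_lt (h : IsPseudorandom G S t)
    (hT : G.IsIndepSet (T : Set V)) (ht : t ≤ #(S ∩ T)) : #(T \ S) < t := by
  by_contra! hcard
  obtain ⟨a, ha, b, hb, hab⟩ :=
    h.exists_adj_of_le (S ∩ T) inter_subset_left (T \ S) disjoint_sdiff ht hcard
  exact hT (mem_inter.1 ha).2 (mem_sdiff.1 hb).1 hab.ne hab

end Pseudorandom

section Pruning

variable {n : ℕ} {G : SimpleGraph (Fin n)} {x : VectorAssignment n} {S T : Finset (Fin n)}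
  {L : Finset (Finset (Fin n))}

theorem mem_candidateList :
    T ∈ candidateList G x ↔
      (∃ u, greedyExtend G (vertexBall x u) = T) ∧ G.IsIndepSet (T : Set (Fin n)) := by
  simp only [candidateList, mem_filter, mem_image, mem_univ, true_and]

theorem mem_removeSmall : T ∈ removeSmall L ↔ T ∈ L ∧ (n : ℝ) ^ (2 / 3 : ℝ) ≤ #T := by
  simp only [removeSmall, mem_filter]

theorem mem_removeMostlyCovered :
    T ∈ removeMostlyCovered L ↔
      T ∈ L ∧ ∀ T' ∈ L, T ≠ T' → (#(T ∩ T') : ℝ) < 2 / 3 * #T := by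
  classical
  simp only [removeMostlyCovered, mem_filter]

theorem mem_removeOverlapping :
    T ∈ removeOverlapping L ↔
      T ∈ L ∧ ∀ T' ∈ L, T ≠ T' → (#(T ∩ T') : ℝ) < 2 * logb 2 n := by
  classical
  simp only [removeOverlapping, mem_filter]

theorem not_subset_of_mem_candidateList (hS : G.IsIndepSet (S : Set (Fin n)))
    (hT : T ∈ candidateList G x) (hne : T ≠ S) : ¬ T ⊆ S := by
  obtain ⟨⟨u, rfl⟩, -⟩ := mem_candidateList.1 hT
  exact fun h => hne (greedyExtend_eq_of_subset hS h)

theorem rpow_two_thirds_eq_sq (n : ℕ) : (n : ℝ) ^ (2 / 3 : ℝ) = ((n : ℝ) ^ (1 / 3 : ℝ)) ^ 2 := by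
  rw [← rpow_mul_natCast n.cast_nonneg]
  norm_num

theorem rpow_one_third_pow_three (n : ℕ) : ((n : ℝ) ^ (1 / 3 : ℝ)) ^ 3 = n := by
  rw [← rpow_mul_natCast n.cast_nonneg]
  norm_num

theorem one_le_rpow_one_third (hn : 1 ≤ n) : 1 ≤ (n : ℝ) ^ (1 / 3 : ℝ) :=
  one_le_rpow (by exact_mod_cast hn) (by norm_num)

theorem logb_two_natCast_nonneg (n : ℕ) : 0 ≤ logb 2 n :=
  div_nonneg (log_natCast_nonneg n) (log_nonneg one_le_two)

theorem card_prunedList_le (hn : 1 ≤ n) (hlog : 6 * logb 2 n ≤ (n : ℝ) ^ (1 / 3 : ℝ)) :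
    #(prunedList G x) ≤ 2 * (n : ℝ) ^ (1 / 3 : ℝ) := by
  have hcard := card_mul_sq_le (L := prunedList G x) (s := (n : ℝ) ^ (2 / 3 : ℝ))
    (l := 2 * logb 2 n) (by positivity) (by linarith [logb_two_natCast_nonneg n])
    (fun T hT => (mem_removeSmall.1
      (mem_removeMostlyCovered.1 (mem_removeOverlapping.1 hT).1).1).2)
    (fun T hT T' hT' hne =>
      ((mem_removeOverlapping.1 hT).2 T' (mem_removeOverlapping.1 hT').1 hne).le)
  have hq := one_le_rpow_one_third hn
  have hq3 := rpow_one_third_pow_three n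
  rw [Fintype.card_fin, rpow_two_thirds_eq_sq] at hcard
  set q := (n : ℝ) ^ (1 / 3 : ℝ)
  set m : ℝ := (#(prunedList G x) : ℝ)
  have hcancel : q ^ 4 * m ≤ q ^ 4 * (q + m / 3) :=
    calc q ^ 4 * m = m * (q ^ 2) ^ 2 := by ring
      _ ≤ n * (q ^ 2 + m * (2 * logb 2 n)) := hcard
      _ ≤ n * (q ^ 2 + m * (q / 3)) := by gcongr; linarith
      _ = q ^ 4 * (q + m / 3) := by rw [← hq3]; ring
  linarith [le_of_mul_le_mul_left hcancel (by positivity)]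

theorem card_inter_lt_of_mem_removeMostlyCovered (hG : IsPseudorandom G S (2 * logb 2 n))
    (hlog : 6 * logb 2 n ≤ (n : ℝ) ^ (2 / 3 : ℝ)) (hS : S ∈ removeSmall (candidateList G x))
    (hT : T ∈ removeMostlyCovered (removeSmall (candidateList G x))) (hne : T ≠ S) :
    #(S ∩ T) < 2 * logb 2 n := by
  by_contra! hge
  obtain ⟨hTL, hcov⟩ := mem_removeMostlyCovered.1 hT
  obtain ⟨hTc, hTn⟩ := mem_removeSmall.1 hTL
  have hinter := hcov S hS hne
  have hsdiff := hG.card_sdiff_lt (mem_candidateList.1 hTc).2 hge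
  have hsplit : (#(T ∩ S) : ℝ) + #(T \ S) = #T := by
    exact_mod_cast card_inter_add_card_sdiff T S
  linarith

theorem mem_prunedList (hG : IsPseudorandom G S (2 * logb 2 n))
    (hlog : 6 * logb 2 n ≤ (n : ℝ) ^ (2 / 3 : ℝ)) (hS : S ∈ removeSmall (candidateList G x)) :
    S ∈ prunedList G x := by
  refine mem_removeOverlapping.2 ⟨mem_removeMostlyCovered.2 ⟨hS, fun T hT hne => ?_⟩,
    fun T hT hne => card_inter_lt_of_mem_removeMostlyCovered hG hlog hS hT hne.symm⟩
  obtain ⟨hTc, -⟩ := mem_removeSmall.1 hT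
  have hcard : (3 * #(S ∩ T) : ℝ) < 2 * #S := by
    exact_mod_cast hG.card_inter_lt (mem_candidateList.1 hTc).2
      (not_subset_of_mem_candidateList hG.isIndepSet hTc hne.symm)
  linarith

theorem recover_eq_some {u : Fin n} (hu : u ∈ S) (hS : S ∈ prunedList G x)
    (huniq : ∀ T ∈ prunedList G x, T ≠ S → u ∉ T) : recover G x u = some S := by
  have hex : ∃! T, T ∈ prunedList G x ∧ u ∈ T :=
    ⟨S, ⟨hS, hu⟩, fun T hT => by_contra fun hne => huniq T hT.1 hne hT.2⟩
  rw [recover, dif_pos hex]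
  exact congrArg some (hex.unique hex.exists.choose_spec ⟨hS, hu⟩)

open scoped Classical in
theorem card_recover_ne_le (hG : IsPseudorandom G S (2 * logb 2 n)) (hn : 1 ≤ n)
    (hlog : 6 * logb 2 n ≤ (n : ℝ) ^ (1 / 3 : ℝ)) (hS : S ∈ removeSmall (candidateList G x)) :
    #{u ∈ S | recover G x u ≠ some S} ≤ 4 * (n : ℝ) ^ (1 / 3 : ℝ) * logb 2 n := by
  have hlog' : 6 * logb 2 n ≤ (n : ℝ) ^ (2 / 3 : ℝ) :=
    hlog.trans (rpow_le_rpow_of_exponent_le (by exact_mod_cast hn) (by norm_num))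
  have hlog0 := logb_two_natCast_nonneg n
  have hsub : {u ∈ S | recover G x u ≠ some S} ⊆
      ((prunedList G x).erase S).biUnion fun T => S ∩ T := fun u hu => by
    obtain ⟨huS, hne⟩ := mem_filter.1 hu
    by_contra hcon
    refine hne (recover_eq_some huS (mem_prunedList hG hlog' hS) fun T hT hTS huT => hcon ?_)
    exact mem_biUnion.2 ⟨T, mem_erase.2 ⟨hTS, hT⟩, mem_inter.2 ⟨huS, huT⟩⟩
  calc (#{u ∈ S | recover G x u ≠ some S} : ℝ)
      ≤ ∑ T ∈ (prunedList G x).erase S, (#(S ∩ T) : ℝ) := by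
        exact_mod_cast (card_le_card hsub).trans card_biUnion_le
    _ ≤ #((prunedList G x).erase S) * (2 * logb 2 n) := by
        rw [← nsmul_eq_mul]
        refine sum_le_card_nsmul _ _ _ fun T hT => ?_
        obtain ⟨hne, hT⟩ := mem_erase.1 hT
        exact (card_inter_lt_of_mem_removeMostlyCovered hG hlog' hS
          (mem_removeOverlapping.1 hT).1 hne).le
    _ ≤ #(prunedList G x) * (2 * logb 2 n) := by
        gcongr
        exact erase_subset _ _
    _ ≤ 2 * (n : ℝ) ^ (1 / 3 : ℝ) * (2 * logb 2 n) := by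
        gcongr
        exact card_prunedList_le hn hlog
    _ = 4 * (n : ℝ) ^ (1 / 3 : ℝ) * logb 2 n := by ring

end Pruning

section Nets

open Metric

-- A `1`-net of the ball of radius `2` is a `1 / 2`-net of the unit ball, scaled to match
-- `Besicovitch.card_le_of_separated`.
theorem packingNumber_one_closedBall_two_le (E : Type*) [NormedAddCommGroup E] [NormedSpace ℝ E]
    [FiniteDimensional ℝ E] :
    packingNumber 1 (closedBall (0 : E) 2) ≤ (5 ^ Module.finrank ℝ E : ℕ) := by
  refine iSup₂_le fun C hC => iSup_le fun hsep => not_lt.1 fun hlt => ?_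
  obtain ⟨D, hDC, hD⟩ := Set.exists_subset_encard_eq (Order.add_one_le_of_lt hlt)
  have hfin : D.Finite := Set.finite_of_encard_eq_coe (k := 5 ^ Module.finrank ℝ E + 1) <| by
    exact_mod_cast hD
  lift D to Finset E using hfin
  have hcard := Besicovitch.card_le_of_separated D
    (fun c hc => mem_closedBall_zero_iff.1 (hC (hDC hc)))
    (fun c hc d hd hcd => by
      have hedist := hsep (hDC hc) (hDC hd) hcd
      rw [ENNReal.coe_one, edist_dist, ENNReal.one_lt_ofReal, dist_eq_norm] at hedist
      exact hedist.le)
  rw [Set.encard_coe_eq_coe_finsetCard] at hD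
  have : #D = 5 ^ Module.finrank ℝ E + 1 := by exact_mod_cast hD
  omega

theorem exists_isCover_one_closedBall_two (E : Type*) [NormedAddCommGroup E] [NormedSpace ℝ E]
    [FiniteDimensional ℝ E] :
    ∃ N : Finset E, #N ≤ 5 ^ Module.finrank ℝ E ∧ (∀ c ∈ N, ‖c‖ ≤ 2) ∧
      IsCover 1 (closedBall (0 : E) 2) (N : Set E) := by
  have hle := (coveringNumber_le_packingNumber 1 (closedBall (0 : E) 2)).trans
    (packingNumber_one_closedBall_two_le E)
  have htop : coveringNumber 1 (closedBall (0 : E) 2) ≠ ⊤ := ne_top_of_le_ne_top (by simp) hle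
  refine ⟨(finite_minimalCover (ε := 1) (A := closedBall (0 : E) 2)).toFinset, ?_, ?_, ?_⟩
  · rw [← encard_minimalCover htop, finite_minimalCover.encard_eq_coe_toFinset_card] at hle
    exact_mod_cast hle
  · exact fun c hc => mem_closedBall_zero_iff.1
      (minimalCover_subset (finite_minimalCover.mem_toFinset.1 hc))
  · rw [Set.Finite.coe_toFinset]
    exact isCover_minimalCover htop

theorem exists_norm_sub_le_of_isCover {E : Type*} [NormedAddCommGroup E] {N : Set E}
    (hN : IsCover 1 (closedBall (0 : E) 2) N) {y : E} (hy : ‖y‖ ≤ 2) :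
    ∃ c ∈ N, ‖y - c‖ ≤ 1 := by
  obtain ⟨c, hc, hyc⟩ := Set.mem_iUnion₂.1
    (hN.subset_iUnion_closedBall (mem_closedBall_zero_iff.2 hy))
  exact ⟨c, hc, mem_closedBall_iff_norm.1 hyc⟩

theorem norm_le_of_isCover {F : Type*} [NormedAddCommGroup F] [InnerProductSpace ℝ F] {N : Set F}
    (hN : IsCover 1 (closedBall (0 : F) 2) N) {w : F} {t : ℝ} (hw : ∀ c ∈ N, inner ℝ c w ≤ t) :
    ‖w‖ ≤ t := by
  have hinner : inner ℝ ((2 * ‖w‖⁻¹) • w) w = 2 * ‖w‖ := by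
    rw [real_inner_smul_left, real_inner_self_eq_norm_sq, mul_assoc, sq, ← mul_assoc ‖w‖⁻¹,
      inv_mul_mul_self]
  have hnorm : ‖(2 * ‖w‖⁻¹) • w‖ ≤ 2 := by
    rw [norm_smul, norm_mul, norm_inv, norm_norm, Real.norm_two, mul_assoc]
    linarith [inv_mul_le_one (a := ‖w‖)]
  obtain ⟨c, hc, hcy⟩ := exists_norm_sub_le_of_isCover hN hnorm
  have : 2 * ‖w‖ ≤ ‖w‖ + t :=
    calc 2 * ‖w‖ = inner ℝ ((2 * ‖w‖⁻¹) • w - c) w + inner ℝ c w := by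
          rw [inner_sub_left, hinner, sub_add_cancel]
      _ ≤ 1 * ‖w‖ + t := add_le_add ((real_inner_le_norm _ _).trans (by gcongr)) (hw c hc)
      _ = ‖w‖ + t := by rw [one_mul]
  linarith

theorem opNorm_le_of_isCover {E F : Type*} [NormedAddCommGroup E] [NormedSpace ℝ E]
    [NormedAddCommGroup F] [NormedSpace ℝ F] (A : E →L[ℝ] F) {N : Set E}
    (hN : IsCover 1 (closedBall (0 : E) 2) N) {t : ℝ} (hA : ∀ d ∈ N, ‖A d‖ ≤ t) : ‖A‖ ≤ t := by
  have ht : 0 ≤ t := by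
    obtain ⟨d, hd, -⟩ := exists_norm_sub_le_of_isCover hN (norm_zero.trans_le zero_le_two)
    exact (norm_nonneg _).trans (hA d hd)
  suffices h : ‖A‖ ≤ (t + ‖A‖) / 2 by linarith
  refine A.opNorm_le_of_unit_norm (by positivity) fun y hy => ?_
  obtain ⟨d, hd, hdy⟩ := exists_norm_sub_le_of_isCover hN (y := (2 : ℝ) • y)
    (by rw [norm_smul, hy, Real.norm_two, mul_one])
  have : 2 * ‖A y‖ ≤ t + ‖A‖ :=
    calc 2 * ‖A y‖ = ‖A d + A ((2 : ℝ) • y - d)‖ := by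
          rw [← map_add, add_sub_cancel, map_smul, norm_smul, Real.norm_two]
      _ ≤ t + ‖A‖ * 1 := (norm_add_le _ _).trans <|
          add_le_add (hA d hd) ((A.le_opNorm _).trans (by gcongr))
      _ = t + ‖A‖ := by rw [mul_one]
  linarith

end Nets

section OpNorm

open scoped Matrix.Norms.L2Operator

variable {m n E : Type*} [Fintype m] [Fintype n] [DecidableEq n] [NormedAddCommGroup E]
  [InnerProductSpace ℝ E]

theorem sum_sum_mul_eq_inner (M : Matrix m n ℝ) (y : EuclideanSpace ℝ m)
    (z : EuclideanSpace ℝ n) :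
    ∑ u, ∑ v, M u v * (y u * z v) = inner ℝ y (Matrix.toEuclideanLin M z) := by
  simp only [PiLp.inner_apply, Matrix.toLpLin_apply, Matrix.mulVec, dotProduct,
    RCLike.inner_apply, conj_trivial, sum_mul]
  exact sum_congr rfl fun u _ => sum_congr rfl fun v _ => by ring

theorem sum_sum_mul_le_l2_opNorm (M : Matrix m n ℝ) (y : EuclideanSpace ℝ m)
    (z : EuclideanSpace ℝ n) : ∑ u, ∑ v, M u v * (y u * z v) ≤ ‖M‖ * (‖y‖ * ‖z‖) := by
  calc ∑ u, ∑ v, M u v * (y u * z v)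
      = inner ℝ y (Matrix.toEuclideanLin M z) := sum_sum_mul_eq_inner M y z
    _ ≤ ‖y‖ * (‖M‖ * ‖z‖) := (real_inner_le_norm _ _).trans <| by
        gcongr
        exact Matrix.l2_opNorm_mulVec M z
    _ = ‖M‖ * (‖y‖ * ‖z‖) := by ring

theorem sum_sum_mul_inner_le_l2_opNorm [FiniteDimensional ℝ E] (M : Matrix m n ℝ) (x : m → E)
    (y : n → E) :
    ∑ u, ∑ v, M u v * inner ℝ (x u) (y v) ≤
      ‖M‖ * (√(∑ u, ‖x u‖ ^ 2) * √(∑ v, ‖y v‖ ^ 2)) := by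
  set b := stdOrthonormalBasis ℝ E
  set X : Fin (Module.finrank ℝ E) → EuclideanSpace ℝ m :=
    fun i => WithLp.toLp 2 fun u => inner ℝ (x u) (b i)
  set Y : Fin (Module.finrank ℝ E) → EuclideanSpace ℝ n :=
    fun i => WithLp.toLp 2 fun v => inner ℝ (b i) (y v)
  have hX : ∑ i, ‖X i‖ ^ 2 = ∑ u, ‖x u‖ ^ 2 := by
    simp only [EuclideanSpace.norm_sq_eq, X]
    rw [sum_comm]
    exact sum_congr rfl fun u _ => b.sum_sq_norm_inner_left (x u)
  have hY : ∑ i, ‖Y i‖ ^ 2 = ∑ v, ‖y v‖ ^ 2 := by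
    simp only [EuclideanSpace.norm_sq_eq, Y]
    rw [sum_comm]
    exact sum_congr rfl fun v _ => b.sum_sq_norm_inner_right (y v)
  calc ∑ u, ∑ v, M u v * inner ℝ (x u) (y v)
      = ∑ u, ∑ v, ∑ i, M u v * (X i u * Y i v) := by
        simp only [← mul_sum, X, Y, b.sum_inner_mul_inner]
    _ = ∑ i, ∑ u, ∑ v, M u v * (X i u * Y i v) := by
        simp only [sum_comm (γ := Fin (Module.finrank ℝ E))]
    _ ≤ ∑ i, ‖M‖ * (‖X i‖ * ‖Y i‖) :=
        sum_le_sum fun i _ => sum_sum_mul_le_l2_opNorm M (X i) (Y i)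
    _ ≤ ‖M‖ * (√(∑ u, ‖x u‖ ^ 2) * √(∑ v, ‖y v‖ ^ 2)) := by
        rw [← mul_sum, ← hX, ← hY]
        gcongr
        exact sum_mul_le_sqrt_mul_sqrt _ _ _

theorem l2_opNorm_le_of_isCover (M : Matrix m n ℝ) {N : Set (EuclideanSpace ℝ m)}
    {N' : Set (EuclideanSpace ℝ n)} (hN : Metric.IsCover 1 (Metric.closedBall 0 2) N)
    (hN' : Metric.IsCover 1 (Metric.closedBall 0 2) N') {t : ℝ}
    (hM : ∀ c ∈ N, ∀ d ∈ N', ∑ u, ∑ v, M u v * (c u * d v) ≤ t) : ‖M‖ ≤ t :=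
  opNorm_le_of_isCover (Matrix.toEuclideanLin M).toContinuousLinearMap hN' fun d hd =>
    norm_le_of_isCover hN fun c hc => (sum_sum_mul_eq_inner M c d).symm.trans_le (hM c hc d hd)

end OpNorm

section Geometry

variable {E : Type*} [NormedAddCommGroup E]

theorem exists_card_filter_norm_sub_le {ι : Type*} {S : Finset ι} {x : ι → E} (hne : S.Nonempty)
    (hsum : ∑ u ∈ S, ∑ v ∈ S, ‖x u - x v‖ ^ 2 ≤ #S ^ 2 / 12) :
    ∃ u ∈ S, 2 * #S ≤ 3 * #{v ∈ S | ‖x u - x v‖ ≤ 1 / 2} := by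
  obtain ⟨u, huS, hu⟩ : ∃ u ∈ S, ∑ v ∈ S, ‖x u - x v‖ ^ 2 ≤ #S / 12 := by
    refine exists_le_of_sum_le hne ?_
    rw [sum_const, nsmul_eq_mul]
    linarith
  refine ⟨u, huS, ?_⟩
  have hfar : #{v ∈ S | ¬ ‖x u - x v‖ ≤ 1 / 2} * (1 / 2 : ℝ) ^ 2 ≤ #S / 12 := by
    rw [← nsmul_eq_mul]
    refine (card_nsmul_le_sum _ _ _ fun v hv => ?_).trans
      ((sum_le_sum_of_subset_of_nonneg (filter_subset _ S) fun _ _ _ => sq_nonneg _).trans hu)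
    gcongr
    exact (not_le.1 (mem_filter.1 hv).2).le
  have hfar : (3 * #{v ∈ S | ¬ ‖x u - x v‖ ≤ 1 / 2} : ℝ) ≤ #S := by linarith
  have hfar : 3 * #{v ∈ S | ¬ ‖x u - x v‖ ≤ 1 / 2} ≤ #S := by exact_mod_cast hfar
  have hadd : #{v ∈ S | ‖x u - x v‖ ≤ 1 / 2} + #{v ∈ S | ¬ ‖x u - x v‖ ≤ 1 / 2} = #S :=
    card_filter_add_card_filter_not _
  omega

variable [InnerProductSpace ℝ E]

theorem exists_unit_orthogonal [FiniteDimensional ℝ E] (s : Finset E)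
    (hs : #s < Module.finrank ℝ E) : ∃ e : E, ‖e‖ = 1 ∧ ∀ v ∈ s, inner ℝ e v = 0 := by
  have hlt : Module.finrank ℝ (Submodule.span ℝ (s : Set E)) < Module.finrank ℝ E :=
    (finrank_span_finset_le_card s).trans_lt hs
  have hadd := Submodule.finrank_add_finrank_orthogonal (Submodule.span ℝ (s : Set E))
  have := Module.nontrivial_of_finrank_pos (R := ℝ)
    (M := (Submodule.span ℝ (s : Set E))ᗮ) (by lia)
  obtain ⟨e, he⟩ := exists_norm_eq (Submodule.span ℝ (s : Set E))ᗮ zero_le_one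
  exact ⟨e, he, fun v hv => Submodule.inner_left_of_mem_orthogonal
    (Submodule.subset_span hv) e.2⟩

theorem one_le_norm_sub_of_inner_eq_zero {a b c : E} (ha : ‖a‖ = 1) (hc : ‖c‖ = 1)
    (hcb : inner ℝ c b = 0) (hab : ‖a - b‖ ≤ 1 / 2) : 1 ≤ ‖c - a‖ := by
  have hinner : inner ℝ c a ≤ 1 / 2 :=
    calc inner ℝ c a = inner ℝ c (a - b) := by rw [inner_sub_right, hcb, sub_zero]
      _ ≤ ‖c‖ * ‖a - b‖ := real_inner_le_norm c (a - b)
      _ ≤ 1 / 2 := by rwa [hc, one_mul]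
  have hsq := norm_sub_sq_real c a
  rw [ha, hc] at hsq
  refine (one_le_sq_iff₀ (norm_nonneg _)).1 ?_
  linarith

end Geometry

section SDP

open scoped Matrix.Norms.L2Operator

theorem sum_sum_eq_of_symm {α : Type*} [Fintype α] [DecidableEq α] (S : Finset α)
    {f : α → α → ℝ} (hf : ∀ u v, f u v = f v u) :
    ∑ u, ∑ v, f u v = ∑ u ∈ S, ∑ v ∈ S, f u v + 2 * ∑ u ∈ S, ∑ v ∈ Sᶜ, f u v +
      ∑ u ∈ Sᶜ, ∑ v ∈ Sᶜ, f u v := by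
  have hcross : ∑ u ∈ Sᶜ, ∑ v ∈ S, f u v = ∑ u ∈ S, ∑ v ∈ Sᶜ, f u v := by
    rw [sum_comm]
    exact sum_congr rfl fun u _ => sum_congr rfl fun v _ => hf v u
  rw [← sum_add_sum_compl S]
  simp only [← sum_add_sum_compl S (f _), sum_add_distrib]
  rw [hcross]
  ring

open scoped Classical in
/-- The `±1` matrix of the pairs between `S` and its complement, with `-1` for the edges of `H`
and `1` for the non-edges: its entries are independent random signs when `H` is drawn from
`randomGraph S`. -/
noncomputable def crossSign {V : Type*} [Fintype V] [DecidableEq V] (H : SimpleGraph V)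
    (S : Finset V) : Matrix S ↥Sᶜ ℝ :=
  Matrix.of fun u v => if H.Adj u v then -1 else 1

variable {n : ℕ} {G H : SimpleGraph (Fin n)} {x : VectorAssignment n} {S : Finset (Fin n)}

/-- The competitor against which an optimal solution is compared: the vectors of `S` are all
replaced by `e`. -/
def collapse (x : VectorAssignment n) (S : Finset (Fin n)) (e : EuclideanSpace ℝ (Fin n)) :
    VectorAssignment n :=
  fun u => if u ∈ S then e else x u

theorem IsFeasible.norm_eq_one (hx : IsFeasible G x) (u : Fin n) : ‖x u‖ = 1 :=
  (pow_eq_one_iff_of_nonneg (norm_nonneg _) two_ne_zero).1 (hx.norm_sq_eq_one u)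

theorem IsFeasible.norm_sub_sq (hx : IsFeasible G x) (u v : Fin n) :
    ‖x u - x v‖ ^ 2 = 2 - 2 * inner ℝ (x u) (x v) := by
  rw [norm_sub_sq_real, hx.norm_sq_eq_one, hx.norm_sq_eq_one]
  ring

theorem IsFeasible.isFeasible_collapse (hx : IsFeasible G x) (hS : G.IsIndepSet (S : Set (Fin n)))
    {e : EuclideanSpace ℝ (Fin n)} (he : ‖e‖ = 1) (horth : ∀ v ∉ S, inner ℝ e (x v) = 0) :
    IsFeasible G (collapse x S e) where
  norm_sq_eq_one u := by
    unfold collapse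
    split_ifs
    · rw [he, one_pow]
    · exact hx.norm_sq_eq_one u
  inner_nonneg u v := by
    unfold collapse
    split_ifs with hu hv hv
    · exact real_inner_self_nonneg
    · exact (horth v hv).ge
    · exact (real_inner_comm e (x u) ▸ horth u hu).ge
    · exact hx.inner_nonneg u v
  inner_eq_zero u v huv := by
    unfold collapse
    split_ifs with hu hv hv
    · exact absurd huv (hS hu hv huv.ne)
    · exact horth v hv
    · exact real_inner_comm e (x u) ▸ horth u hu
    · exact hx.inner_eq_zero u v huv

theorem IsFeasible.objective_collapse (hx : IsFeasible G x)
    (hS : G.IsIndepSet (S : Set (Fin n))) {e : EuclideanSpace ℝ (Fin n)} (he : ‖e‖ = 1)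
    (horth : ∀ v ∉ S, inner ℝ e (x v) = 0) :
    objective (collapse x S e) =
      2 * ∑ _u ∈ S, ∑ _v ∈ Sᶜ, (2 : ℝ) + ∑ u ∈ Sᶜ, ∑ v ∈ Sᶜ, ‖x u - x v‖ ^ 2 := by
  set y := collapse x S e
  have hy : IsFeasible G y := hx.isFeasible_collapse hS he horth
  have hyS : ∀ u ∈ S, y u = e := fun u hu => if_pos hu
  have hyC : ∀ u ∈ Sᶜ, y u = x u := fun u hu => if_neg (mem_compl.1 hu)
  have hin : ∑ u ∈ S, ∑ v ∈ S, ‖y u - y v‖ ^ 2 = 0 :=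
    sum_eq_zero fun u hu => sum_eq_zero fun v hv => by
      rw [hyS u hu, hyS v hv, sub_self, norm_zero, zero_pow two_ne_zero]
  have hcross : ∑ u ∈ S, ∑ v ∈ Sᶜ, ‖y u - y v‖ ^ 2 = ∑ _u ∈ S, ∑ _v ∈ Sᶜ, (2 : ℝ) :=
    sum_congr rfl fun u hu => sum_congr rfl fun v hv => by
      rw [hy.norm_sub_sq, hyS u hu, hyC v hv, horth v (mem_compl.1 hv), mul_zero, sub_zero]
  have hout : ∑ u ∈ Sᶜ, ∑ v ∈ Sᶜ, ‖y u - y v‖ ^ 2 = ∑ u ∈ Sᶜ, ∑ v ∈ Sᶜ, ‖x u - x v‖ ^ 2 :=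
    sum_congr rfl fun u hu => sum_congr rfl fun v hv => by rw [hyC u hu, hyC v hv]
  rw [objective, sum_sum_eq_of_symm S fun u v => by rw [norm_sub_rev], hin, hcross, hout, zero_add]

theorem IsOptimal.sum_norm_sub_sq_le (hx : IsOptimal G x) (hS : G.IsIndepSet (S : Set (Fin n)))
    (hne : S.Nonempty) :
    ∑ u ∈ S, ∑ v ∈ S, ‖x u - x v‖ ^ 2 ≤ 4 * ∑ u ∈ S, ∑ v ∈ Sᶜ, inner ℝ (x u) (x v) := by
  classical
  have hcard : #(Sᶜ.image x) < Module.finrank ℝ (EuclideanSpace ℝ (Fin n)) := by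
    rw [finrank_euclideanSpace, ← card_add_card_compl S]
    exact card_image_le.trans_lt (Nat.lt_add_of_pos_left hne.card_pos)
  obtain ⟨e, he, horth⟩ := exists_unit_orthogonal _ hcard
  have horth : ∀ v ∉ S, inner ℝ e (x v) = 0 := fun v hv =>
    horth _ (mem_image_of_mem x (mem_compl.2 hv))
  have hopt := hx.objective_le _ (hx.feasible.isFeasible_collapse hS he horth)
  rw [hx.feasible.objective_collapse hS he horth, objective,
    sum_sum_eq_of_symm S fun u v => by rw [norm_sub_rev]] at hopt
  have hcross : ∑ u ∈ S, ∑ v ∈ Sᶜ, ‖x u - x v‖ ^ 2 =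
      ∑ _u ∈ S, ∑ _v ∈ Sᶜ, (2 : ℝ) - 2 * ∑ u ∈ S, ∑ v ∈ Sᶜ, inner ℝ (x u) (x v) := by
    simp only [hx.feasible.norm_sub_sq, sum_sub_distrib, mul_sum]
  linarith

theorem IsFeasible.sum_inner_le (hx : IsFeasible G x) (hHG : H ≤ G) (S : Finset (Fin n)) :
    ∑ u ∈ S, ∑ v ∈ Sᶜ, inner ℝ (x u) (x v) ≤ ‖crossSign H S‖ * (√(#S) * √n) := by
  have hsign : ∀ (u : S) (v : ↥Sᶜ),
      crossSign H S u v * inner ℝ (x u) (x v) = inner ℝ (x u) (x v) := fun u v => by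
    rw [crossSign, Matrix.of_apply]
    split_ifs with huv
    · rw [hx.inner_eq_zero u v (hHG huv), mul_zero]
    · rw [one_mul]
  calc ∑ u ∈ S, ∑ v ∈ Sᶜ, inner ℝ (x u) (x v)
      = ∑ u : S, ∑ v : ↥Sᶜ, crossSign H S u v * inner ℝ (x u) (x v) := by
        simp only [hsign, ← sum_coe_sort S, ← sum_coe_sort Sᶜ]
    _ ≤ ‖crossSign H S‖ * (√(∑ u : S, ‖x u‖ ^ 2) * √(∑ v : ↥Sᶜ, ‖x v‖ ^ 2)) :=
        sum_sum_mul_inner_le_l2_opNorm _ (fun u : S => x u) (fun v : ↥Sᶜ => x v)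
    _ = ‖crossSign H S‖ * (√(#S) * √(#Sᶜ)) := by
        simp only [hx.norm_sq_eq_one, sum_const, card_univ, Fintype.card_coe, nsmul_eq_mul,
          mul_one]
    _ ≤ ‖crossSign H S‖ * (√(#S) * √n) := by
        gcongr
        exact card_finset_fin_le Sᶜ

theorem mem_candidateList_of_card_filter_le {t : ℝ} {u : Fin n} (hx : IsFeasible G x)
    (hG : IsPseudorandom G S t) (hu : 2 * #S ≤ 3 * #{v ∈ S | ‖x u - x v‖ ≤ 1 / 2}) :
    S ∈ candidateList G x := by
  refine mem_candidateList.2 ⟨⟨u, greedyExtend_eq hG.isIndepSet (fun v hv => ?_) fun v hv => ?_⟩,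
    hG.isIndepSet⟩
  · by_contra hvS
    obtain ⟨w, hw, hwv⟩ := hG.exists_adj v hvS _ (filter_subset _ S) hu
    have hdist := one_le_norm_sub_of_inner_eq_zero (hx.norm_eq_one u) (hx.norm_eq_one v)
      (hx.inner_eq_zero v w hwv.symm) (mem_filter.1 hw).2
    exact hdist.not_gt (mem_filter.1 hv).2
  · obtain ⟨w, hw, hwv⟩ := hG.exists_adj v hv _ (filter_subset _ S) hu
    refine ⟨w, mem_filter.2 ⟨mem_univ w, ?_⟩, hwv.symm⟩
    rw [norm_sub_rev]
    exact (mem_filter.1 hw).2.trans_lt (by norm_num)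

theorem IsOptimal.mem_candidateList {t : ℝ} (hx : IsOptimal G x) (hG : IsPseudorandom G S t)
    (hHG : H ≤ G) (hne : S.Nonempty) (hnorm : 48 * (‖crossSign H S‖ * (√(#S) * √n)) ≤ #S ^ 2) :
    S ∈ candidateList G x := by
  have hsum := hx.sum_norm_sub_sq_le hG.isIndepSet hne
  have hinner := hx.feasible.sum_inner_le hHG S
  obtain ⟨u, -, hu⟩ := exists_card_filter_norm_sub_le (x := x) hne (by linarith)
  exact mem_candidateList_of_card_filter_le hx.feasible hG hu

end SDP

section RademacherSums

variable {α : Type*} [Fintype α] [DecidableEq α] {a : α → ℝ} {c t : ℝ}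

theorem sum_exp_sum_mul_ite (a : α → ℝ) :
    ∑ R : Finset α, exp (∑ p, (if p ∈ R then -1 else 1) * a p) = ∏ p, (2 * cosh (a p)) := by
  have hcosh : ∀ p, 2 * cosh (a p) = exp (-a p) + exp (a p) := fun p => by rw [cosh_eq]; ring
  simp_rw [hcosh]
  rw [Fintype.prod_add]
  refine sum_congr rfl fun R _ => ?_
  rw [exp_sum, ← prod_mul_prod_compl R]
  congr 1
  · exact prod_congr rfl fun p hp => by rw [if_pos hp, neg_one_mul]
  · exact prod_congr rfl fun p hp => by rw [if_neg (mem_compl.1 hp), one_mul]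

theorem sum_exp_sum_mul_ite_le (a : α → ℝ) :
    ∑ R : Finset α, exp (∑ p, (if p ∈ R then -1 else 1) * a p) ≤
      2 ^ Fintype.card α * exp ((∑ p, a p ^ 2) / 2) := by
  rw [sum_exp_sum_mul_ite, prod_mul_distrib, prod_const, sum_div, exp_sum, card_univ]
  gcongr
  exact cosh_le_exp_half_sq _

theorem card_filter_le_sum_mul_ite_le (hc : 0 < c) (ha : ∑ p, a p ^ 2 ≤ c) (ht : 0 ≤ t) :
    (#{R : Finset α | t ≤ ∑ p, (if p ∈ R then -1 else 1) * a p} : ℝ) ≤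
      2 ^ Fintype.card α * exp (-t ^ 2 / (2 * c)) := by
  -- Hoeffding's inequality: exponential Markov with the optimal parameter `t / c`.
  have hmarkov : (#{R : Finset α | t ≤ ∑ p, (if p ∈ R then -1 else 1) * a p} : ℝ) *
      exp (t / c * t) ≤
      ∑ R : Finset α, exp (∑ p, (if p ∈ R then -1 else 1) * (t / c * a p)) := by
    rw [← nsmul_eq_mul]
    refine (card_nsmul_le_sum _ _ _ fun R hR => ?_).trans
      (sum_le_univ_sum_of_nonneg fun R => (exp_pos _).le)
    simp only [mul_left_comm _ (t / c), ← mul_sum]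
    gcongr
    exact (mem_filter.1 hR).2
  have hexp : (∑ p, (t / c * a p) ^ 2) / 2 ≤ t ^ 2 / (2 * c) :=
    calc (∑ p, (t / c * a p) ^ 2) / 2 = (t / c) ^ 2 * (∑ p, a p ^ 2) / 2 := by
          simp only [mul_pow, ← mul_sum]
      _ ≤ (t / c) ^ 2 * c / 2 := by gcongr
      _ = t ^ 2 / (2 * c) := by field_simp
  refine le_of_mul_le_mul_right ?_ (exp_pos (t / c * t))
  calc _ ≤ 2 ^ Fintype.card α * exp ((∑ p, (t / c * a p) ^ 2) / 2) :=
        hmarkov.trans (sum_exp_sum_mul_ite_le _)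
    _ ≤ 2 ^ Fintype.card α * exp (t ^ 2 / (2 * c)) := by gcongr
    _ = 2 ^ Fintype.card α * exp (-t ^ 2 / (2 * c)) * exp (t / c * t) := by
        rw [mul_assoc, ← exp_add]
        congr 2
        field_simp
        ring

end RademacherSums

section RandomGraph

instance {V : Type*} [Finite V] : DiscreteMeasurableSpace (SimpleGraph V) where
  forall_measurableSet s := by
    rw [← Set.preimage_image_eq s SimpleGraph.edgeSet_injective]
    exact SimpleGraph.measurable_edgeSet (Set.toFinite _).measurableSet

theorem measureReal_le_card_mul {Ω ι : Type*} [MeasurableSpace Ω] {μ : Measure Ω}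
    [IsFiniteMeasure μ] {s : Finset ι} {E : Set Ω} {F : ι → Set Ω} {ε : ℝ}
    (hE : ∀ ω ∈ E, ∃ i ∈ s, ω ∈ F i) (hF : ∀ i ∈ s, μ.real (F i) ≤ ε) : μ.real E ≤ #s * ε :=
  calc μ.real E ≤ μ.real (⋃ i ∈ s, F i) :=
        measureReal_mono (fun ω hω => Set.mem_iUnion₂.2 (by simpa using hE ω hω))
          (measure_ne_top μ _)
    _ ≤ ∑ i ∈ s, μ.real (F i) := measureReal_biUnion_finset_le _ _
    _ ≤ #s * ε := by simpa using sum_le_card_nsmul s _ _ hF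

open scoped Classical in
theorem setBernoulli_range_half_real {α β : Type*} [Fintype α] [Countable β] {f : α → β}
    (hf : Function.Injective f) (Q : Set (Set β)) :
    (setBernoulli (Set.range f) half).real Q =
      (#{R : Finset α | f '' (R : Set α) ∈ Q} : ℝ) / 2 ^ Fintype.card α := by
  have hinj : Function.Injective fun R : Finset α => f '' (R : Set α) :=
    hf.image_injective.comp coe_injective
  have hset : {s ∈ Q | s ⊆ Set.range f} = (image (fun R : Finset α => f '' (R : Set α))
      {R : Finset α | f '' (R : Set α) ∈ Q} : Finset (Set β)) := by
    ext s
    simp only [coe_image, coe_filter, mem_univ, true_and, Set.mem_image, Set.mem_ofPred_eq]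
    constructor
    · rintro ⟨hsQ, hs⟩
      obtain ⟨t, rfl⟩ := Set.subset_range_iff_exists_image_eq.1 hs
      exact ⟨t.toFinset, by simpa using hsQ, by simp⟩
    · rintro ⟨R, hR, rfl⟩
      exact ⟨hR, Set.image_subset_range f R⟩
  have hsingle : ∀ R : Finset α, (setBernoulli (Set.range f) half).real {f '' (R : Set α)} =
      1 / 2 ^ Fintype.card α := fun R => by
    have hcard := Set.ncard_sdiff_add_ncard_of_subset (Set.image_subset_range f (R : Set α))
    rw [Set.ncard_range_of_injective hf, Nat.card_eq_fintype_card] at hcard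
    rw [setBernoulli_real_singleton half (Set.image_subset_range f R) (Set.finite_range f),
      show (half : ℝ) = 1 / 2 from rfl, show (1 - 1 / 2 : ℝ) = 1 / 2 by norm_num, ← pow_add,
      add_comm, hcard, one_div_pow]
  rw [measureReal_def, setBernoulli_apply_eq_apply_subsets, hset, ← measureReal_def,
    ← sum_measureReal_singleton, sum_image hinj.injOn]
  simp only [hsingle, sum_const, nsmul_eq_mul, mul_one_div]

section CrossGraph

variable {V : Type*} [Fintype V] [DecidableEq V] {S : Finset V}

/-- The bipartite graph between `S` and its complement with the edges listed in `R`. -/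
def crossGraph (S : Finset V) (R : Finset (S × ↥Sᶜ)) : SimpleGraph V :=
  SimpleGraph.fromEdgeSet ((fun p : S × ↥Sᶜ => s((p.1 : V), (p.2 : V))) '' (R : Set (S × ↥Sᶜ)))

theorem injective_mk_cross (S : Finset V) :
    Function.Injective fun p : S × ↥Sᶜ => s((p.1 : V), (p.2 : V)) := by
  rintro ⟨u, v⟩ ⟨u', v'⟩ h
  rcases Sym2.eq_iff.1 h with ⟨hu, hv⟩ | ⟨hu, -⟩
  · exact Prod.ext (Subtype.ext hu) (Subtype.ext hv)
  · exact absurd (hu ▸ u.2) (mem_compl.1 v'.2)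

theorem crossGraph_adj {R : Finset (S × ↥Sᶜ)} {u : S} {v : ↥Sᶜ} :
    (crossGraph S R).Adj u v ↔ (u, v) ∈ R := by
  have hne : (u : V) ≠ v := fun h => mem_compl.1 v.2 (h ▸ u.2)
  rw [crossGraph, SimpleGraph.fromEdgeSet_adj, and_iff_left hne]
  exact (injective_mk_cross S).mem_set_image (a := (u, v))

theorem isIndepSet_crossGraph (R : Finset (S × ↥Sᶜ)) :
    (crossGraph S R).IsIndepSet (S : Set V) := by
  rintro u hu v hv - hadj
  obtain ⟨⟨⟨a, b⟩, -, hab⟩, -⟩ := (SimpleGraph.fromEdgeSet_adj _).1 hadj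
  rcases Sym2.eq_iff.1 hab with ⟨-, rfl⟩ | ⟨-, rfl⟩
  · exact mem_compl.1 b.2 hv
  · exact mem_compl.1 b.2 hu

theorem crossSign_crossGraph (R : Finset (S × ↥Sᶜ)) (u : S) (v : ↥Sᶜ) :
    crossSign (crossGraph S R) S u v = if (u, v) ∈ R then -1 else 1 := by
  simp only [crossSign, Matrix.of_apply, crossGraph_adj]

end CrossGraph

variable {n : ℕ} {S : Finset (Fin n)} {t : ℝ}

theorem boundary_eq_range (S : Finset (Fin n)) :
    boundary S = Set.range fun p : S × ↥Sᶜ => s((p.1 : Fin n), (p.2 : Fin n)) := by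
  ext e
  constructor
  · rintro ⟨u, hu, v, hv, rfl⟩
    exact ⟨(⟨u, hu⟩, ⟨v, mem_compl.2 hv⟩), rfl⟩
  · rintro ⟨⟨u, v⟩, rfl⟩
    exact ⟨u, u.2, v, mem_compl.1 v.2, rfl⟩

instance : IsProbabilityMeasure (randomGraph S) :=
  Measure.isProbabilityMeasure_map SimpleGraph.measurable_fromEdgeSet.aemeasurable

theorem randomGraph_real_apply (S : Finset (Fin n)) (Q : Set (SimpleGraph (Fin n)))
    [DecidablePred fun R => crossGraph S R ∈ Q] :
    (randomGraph S).real Q = (#{R | crossGraph S R ∈ Q} : ℝ) / 2 ^ Fintype.card (S × ↥Sᶜ) := by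
  rw [randomGraph, map_measureReal_apply SimpleGraph.measurable_fromEdgeSet .of_discrete,
    boundary_eq_range, setBernoulli_range_half_real (injective_mk_cross S)]
  congr!

theorem randomGraph_real_not_isIndepSet (S : Finset (Fin n)) :
    (randomGraph S).real {H | ¬ H.IsIndepSet (S : Set (Fin n))} = 0 := by
  classical
  simp [randomGraph_real_apply, isIndepSet_crossGraph]

theorem randomGraph_real_le_sum_crossSign_le {a : S → ↥Sᶜ → ℝ} {c : ℝ} (hc : 0 < c)
    (ha : ∑ u, ∑ v, a u v ^ 2 ≤ c) (ht : 0 ≤ t) :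
    (randomGraph S).real {H | t ≤ ∑ u, ∑ v, crossSign H S u v * a u v} ≤
      exp (-t ^ 2 / (2 * c)) := by
  classical
  rw [← Fintype.sum_prod_type' fun u v => a u v ^ 2] at ha
  rw [randomGraph_real_apply, div_le_iff₀' (by positivity)]
  refine le_of_eq_of_le ?_ (card_filter_le_sum_mul_ite_le hc ha ht)
  simp only [Set.mem_ofPred_eq, crossSign_crossGraph, Fintype.sum_prod_type]

theorem randomGraph_real_forall_not_adj_le (A : Finset S) (B : Finset ↥Sᶜ) :
    (randomGraph S).real {H | ∀ a ∈ A, ∀ b ∈ B, ¬ H.Adj a b} ≤ 1 / 2 ^ (#A * #B) := by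
  classical
  rw [randomGraph_real_apply, div_le_div_iff₀ (by positivity) (by positivity), one_mul,
    ← card_compl_add_card (A ×ˢ B), pow_add, card_product]
  gcongr
  refine mod_cast (card_le_card (t := (A ×ˢ B)ᶜ.powerset) fun R hR => ?_).trans_eq
    (card_powerset _)
  rw [mem_filter_univ] at hR
  refine mem_powerset.2 fun p hp => mem_compl.2 fun hpAB => ?_
  obtain ⟨ha, hb⟩ := mem_product.1 hpAB
  exact hR p.1 ha p.2 hb (crossGraph_adj.2 hp)

end RandomGraph

section FailureProbabilities

open scoped Matrix.Norms.L2Operator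

variable {n : ℕ} {S : Finset (Fin n)} {t : ℝ}

theorem randomGraph_real_lt_norm_crossSign_le (ht : 0 ≤ t) :
    (randomGraph S).real {H | t < ‖crossSign H S‖} ≤ 5 ^ n * exp (-t ^ 2 / 32) := by
  obtain ⟨N, hNcard, hN2, hN⟩ := exists_isCover_one_closedBall_two (EuclideanSpace ℝ S)
  obtain ⟨N', hNcard', hN2', hN'⟩ := exists_isCover_one_closedBall_two (EuclideanSpace ℝ ↥Sᶜ)
  have hcover : ∀ H ∈ {H | t < ‖crossSign H S‖}, ∃ q ∈ N ×ˢ N',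
      H ∈ {H | t ≤ ∑ u, ∑ v, crossSign H S u v * (q.1 u * q.2 v)} := fun H hH => by
    by_contra! hsmall
    refine (Set.mem_ofPred.1 hH).not_ge (l2_opNorm_le_of_isCover _ hN hN' fun c hc d hd => ?_)
    exact (not_le.1 (hsmall (c, d) (mem_product.2 ⟨hc, hd⟩))).le
  have hcard : #(N ×ˢ N') ≤ 5 ^ n := by
    rw [finrank_euclideanSpace, Fintype.card_coe] at hNcard hNcard'
    calc #(N ×ˢ N') ≤ 5 ^ #S * 5 ^ #Sᶜ := by rw [card_product]; gcongr
      _ = 5 ^ n := by rw [← pow_add, card_add_card_compl, Fintype.card_fin]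
  refine (measureReal_le_card_mul hcover (ε := exp (-t ^ 2 / 32)) fun q hq => ?_).trans
    (by gcongr; exact_mod_cast hcard)
  obtain ⟨hc, hd⟩ := mem_product.1 hq
  have hsum : ∑ u, ∑ v, (q.1 u * q.2 v) ^ 2 ≤ 16 :=
    calc ∑ u, ∑ v, (q.1 u * q.2 v) ^ 2 = ‖q.1‖ ^ 2 * ‖q.2‖ ^ 2 := by
          simp only [EuclideanSpace.real_norm_sq_eq, sum_mul_sum, mul_pow]
      _ ≤ 2 ^ 2 * 2 ^ 2 := by gcongr; exacts [hN2 _ hc, hN2' _ hd]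
      _ = 16 := by norm_num
  exact (randomGraph_real_le_sum_crossSign_le (by norm_num) hsum ht).trans_eq (by norm_num)

theorem card_div_three_le_sum_crossSign {H : SimpleGraph (Fin n)} {T : Finset (Fin n)}
    {v : ↥Sᶜ} (hTS : T ⊆ S) (hT : 2 * #S ≤ 3 * #T) (hv : ∀ u ∈ T, ¬ H.Adj u v) :
    (#S : ℝ) / 3 ≤ ∑ u, crossSign H S u v := by
  have hone : ∀ u : S, 2 * (if (u : Fin n) ∈ T then (1 : ℝ) else 0) - 1 ≤ crossSign H S u v :=
    fun u => by
      by_cases hu : (u : Fin n) ∈ T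
      · norm_num [crossSign, hu, hv u hu]
      · simp only [crossSign, Matrix.of_apply, if_neg hu]
        split_ifs <;> norm_num
  have hcount : ∑ u : S, (if (u : Fin n) ∈ T then (1 : ℝ) else 0) = #T := by
    rw [sum_coe_sort S fun u => if u ∈ T then (1 : ℝ) else 0, sum_boole,
      filter_mem_eq_inter, inter_eq_right.2 hTS]
  have hT' : (2 * #S : ℝ) ≤ 3 * #T := by exact_mod_cast hT
  calc (#S : ℝ) / 3 ≤ 2 * #T - #S := by linarith
    _ = ∑ u : S, (2 * (if (u : Fin n) ∈ T then (1 : ℝ) else 0) - 1) := by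
        rw [sum_sub_distrib, ← mul_sum, hcount]; simp
    _ ≤ ∑ u, crossSign H S u v := sum_le_sum fun u _ => hone u

theorem randomGraph_real_exists_not_adj_le (hS : S.Nonempty) :
    (randomGraph S).real
      {H | ∃ v ∉ S, ∃ T ⊆ S, 2 * #S ≤ 3 * #T ∧ ∀ u ∈ T, ¬ H.Adj u v} ≤
      n * exp (-(#S / 18)) := by
  have hpos : (0 : ℝ) < #S := by exact_mod_cast hS.card_pos
  refine (measureReal_le_card_mul (s := (univ : Finset ↥Sᶜ)) (ε := exp (-(#S / 18)))
    (F := fun v => {H | (#S : ℝ) / 3 ≤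
      ∑ u, ∑ w, crossSign H S u w * (if w = v then 1 else 0)}) ?_ fun v _ => ?_).trans ?_
  · rintro H ⟨v, hv, T, hTS, hT, hTv⟩
    refine ⟨⟨v, mem_compl.2 hv⟩, mem_univ _, ?_⟩
    simpa using card_div_three_le_sum_crossSign (v := ⟨v, mem_compl.2 hv⟩) hTS hT hTv
  · refine (randomGraph_real_le_sum_crossSign_le (c := #S) hpos (by simp) (by positivity)).trans_eq
      ?_
    congr 1
    field_simp
    norm_num
  · gcongr
    simpa using card_le_univ Sᶜ

theorem exists_card_eq_forall_mem {α : Type*} {p : α → Prop} {A : Finset α} {m : ℕ}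
    (hA : ∀ a ∈ A, p a) (hm : m ≤ #A) :
    ∃ A' : Finset (Subtype p), #A' = m ∧ ∀ a ∈ A', (a : α) ∈ A := by
  classical
  obtain ⟨A', hA', hcard⟩ := exists_subset_card_eq (s := A.subtype p) (n := m)
    (by rwa [card_subtype, filter_true_of_mem hA])
  exact ⟨A', hcard, fun a ha => mem_subtype.1 (hA' ha)⟩

theorem choose_card_mul_choose_card_compl_le (S : Finset (Fin n)) (m : ℕ) :
    ((#S).choose m * (#Sᶜ).choose m : ℝ) ≤ (n ^ 2 / 4) ^ m := by
  have hadd : (#S : ℝ) + #Sᶜ = n := by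
    exact_mod_cast (card_add_card_compl S).trans (Fintype.card_fin n)
  calc ((#S).choose m * (#Sᶜ).choose m : ℝ) ≤ (#S : ℝ) ^ m * (#Sᶜ : ℝ) ^ m := by
        gcongr <;> exact_mod_cast Nat.choose_le_pow _ _
    _ = (#S * #Sᶜ : ℝ) ^ m := (mul_pow _ _ _).symm
    _ ≤ (n ^ 2 / 4) ^ m := by
        gcongr
        rw [← hadd]
        linarith [four_mul_le_sq_add (#S : ℝ) #Sᶜ]

theorem randomGraph_real_exists_forall_not_adj_le {m : ℕ} (hm : (n : ℝ) ^ 2 ≤ 2 ^ m) :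
    (randomGraph S).real {H | ∃ A ⊆ S, ∃ B, Disjoint S B ∧ m ≤ #A ∧ m ≤ #B ∧
      ∀ a ∈ A, ∀ b ∈ B, ¬ H.Adj a b} ≤ (1 / 4) ^ m := by
  refine (measureReal_le_card_mul (ε := 1 / 2 ^ (m * m))
    (s := powersetCard m (univ : Finset S) ×ˢ powersetCard m (univ : Finset ↥Sᶜ))
    (F := fun q => {H | ∀ a ∈ q.1, ∀ b ∈ q.2, ¬ H.Adj a b}) ?_ fun q hq => ?_).trans ?_
  · rintro H ⟨A, hA, B, hB, hAm, hBm, hAB⟩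
    obtain ⟨A', hA'm, hA'⟩ := exists_card_eq_forall_mem hA hAm
    obtain ⟨B', hB'm, hB'⟩ :=
      exists_card_eq_forall_mem (p := (· ∈ Sᶜ)) (subset_compl_iff_disjoint_left.2 hB) hBm
    exact ⟨(A', B'), mem_product.2 ⟨mem_powersetCard_univ.2 hA'm, mem_powersetCard_univ.2 hB'm⟩,
      fun a ha b hb => hAB a (hA' a ha) b (hB' b hb)⟩
  · obtain ⟨hA, hB⟩ := mem_product.1 hq
    have hle := randomGraph_real_forall_not_adj_le q.1 q.2
    rwa [mem_powersetCard_univ.1 hA, mem_powersetCard_univ.1 hB] at hle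
  · rw [card_product, card_powersetCard, card_powersetCard, card_univ, card_univ,
      Fintype.card_coe, Fintype.card_coe, Nat.cast_mul]
    calc _ ≤ ((n : ℝ) ^ 2 / 4) ^ m * (1 / 2 ^ (m * m)) := by
          gcongr
          exact choose_card_mul_choose_card_compl_le S m
      _ ≤ (2 ^ m / 4) ^ m * (1 / 2 ^ (m * m)) := by gcongr
      _ = (1 / 4) ^ m := by
          rw [div_pow, ← pow_mul, one_div_pow]
          field_simp

theorem randomGraph_real_not_isPseudorandom_le (hS : S.Nonempty) (ht : (n : ℝ) ^ 2 ≤ 2 ^ ⌈t⌉₊) :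
    (randomGraph S).real {H | ¬ IsPseudorandom H S t} ≤
      n * exp (-(#S / 18)) + (1 / 4) ^ ⌈t⌉₊ := by
  set dependent := {H : SimpleGraph (Fin n) | ¬ H.IsIndepSet (S : Set (Fin n))}
  set poorlyJoined := {H : SimpleGraph (Fin n) |
    ∃ v ∉ S, ∃ T ⊆ S, 2 * #S ≤ 3 * #T ∧ ∀ u ∈ T, ¬ H.Adj u v}
  set edgeless := {H : SimpleGraph (Fin n) | ∃ A ⊆ S, ∃ B, Disjoint S B ∧ ⌈t⌉₊ ≤ #A ∧ ⌈t⌉₊ ≤ #B ∧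
    ∀ a ∈ A, ∀ b ∈ B, ¬ H.Adj a b}
  have hsub : {H | ¬ IsPseudorandom H S t} ⊆ dependent ∪ (poorlyJoined ∪ edgeless) := fun H hH => by
    contrapose! hH
    simp only [Set.mem_union, not_or] at hH
    obtain ⟨hdependent, hpoorlyJoined, hedgeless⟩ := hH
    refine Set.notMem_ofPred_iff.2 (not_not.2 ⟨not_not.1 hdependent, fun v hv T hT hcard => ?_,
      fun A hA B hB hAt hBt => ?_⟩)
    · by_contra! hno
      exact hpoorlyJoined ⟨v, hv, T, hT, hcard, hno⟩
    · by_contra! hno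
      exact hedgeless ⟨A, hA, B, hB, Nat.ceil_le.2 hAt, Nat.ceil_le.2 hBt, hno⟩
  calc (randomGraph S).real {H | ¬ IsPseudorandom H S t}
      ≤ (randomGraph S).real (dependent ∪ (poorlyJoined ∪ edgeless)) :=
        measureReal_mono hsub (measure_ne_top _ _)
    _ ≤ (randomGraph S).real dependent +
          ((randomGraph S).real poorlyJoined + (randomGraph S).real edgeless) :=
        (measureReal_union_le _ _).trans (by gcongr; exact measureReal_union_le _ _)
    _ ≤ 0 + (n * exp (-(#S / 18)) + (1 / 4) ^ ⌈t⌉₊) := by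
        gcongr
        · exact (randomGraph_real_not_isIndepSet S).le
        · exact randomGraph_real_exists_not_adj_le hS
        · exact randomGraph_real_exists_forall_not_adj_le ht
    _ = n * exp (-(#S / 18)) + (1 / 4) ^ ⌈t⌉₊ := zero_add _

theorem five_pow_mul_exp_le (hn : 1 ≤ n) : 5 ^ n * exp (-(16 * √n) ^ 2 / 32) ≤ 1 / n := by
  have hpos : (0 : ℝ) < n := by exact_mod_cast hn
  calc 5 ^ n * exp (-(16 * √n) ^ 2 / 32) = 5 ^ n * exp (-(8 * n)) := by
        rw [mul_pow, sq_sqrt hpos.le]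
        ring_nf
    _ ≤ exp 7 ^ n * exp (-(8 * n)) := by
        gcongr
        linarith [add_one_le_exp (7 : ℝ)]
    _ = (exp n)⁻¹ := by
        rw [← exp_nat_mul, ← exp_add, ← exp_neg]
        ring_nf
    _ ≤ 1 / n := by
        rw [one_div]
        gcongr
        linarith [add_one_le_exp (n : ℝ)]

theorem mul_exp_neg_le {k : ℝ} (hn : 1 ≤ n) (hk : 100 * (n : ℝ) ^ (2 / 3 : ℝ) ≤ k) :
    n * exp (-(k / 18)) ≤ 6 / n := by
  have hpos : (0 : ℝ) < n := by exact_mod_cast hn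
  set b : ℝ := (n : ℝ) ^ (2 / 3 : ℝ) with hb
  have hb0 : 0 ≤ b := by positivity
  have hb3 : b ^ 3 = (n : ℝ) ^ 2 := by
    rw [hb, rpow_two_thirds_eq_sq, ← pow_mul, mul_comm, pow_mul, rpow_one_third_pow_three]
  have hexp : (n : ℝ) ^ 2 / 6 ≤ exp (k / 18) :=
    calc (n : ℝ) ^ 2 / 6 = b ^ 3 / (Nat.factorial 3 : ℝ) := by rw [hb3]; norm_num [Nat.factorial]
      _ ≤ exp b := pow_div_factorial_le_exp b hb0 3
      _ ≤ exp (k / 18) := exp_le_exp.2 (by linarith)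
  rw [exp_neg, ← div_eq_mul_inv, div_le_div_iff₀ (exp_pos _) hpos]
  linarith

theorem sq_le_two_pow_ceil_logb (hn : 1 ≤ n) : (n : ℝ) ^ 2 ≤ 2 ^ ⌈2 * logb 2 n⌉₊ := by
  have hpos : (0 : ℝ) < n := by exact_mod_cast hn
  calc (n : ℝ) ^ 2 = 2 ^ (2 * logb 2 n) := by
        rw [mul_comm, rpow_mul zero_le_two, rpow_logb two_pos (by norm_num) hpos, rpow_two]
    _ ≤ 2 ^ (⌈2 * logb 2 n⌉₊ : ℝ) := rpow_le_rpow_of_exponent_le one_le_two (Nat.le_ceil _)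
    _ = 2 ^ ⌈2 * logb 2 n⌉₊ := rpow_natCast _ _

theorem one_fourth_pow_ceil_logb_le (hn : 1 ≤ n) : (1 / 4 : ℝ) ^ ⌈2 * logb 2 n⌉₊ ≤ 1 / n := by
  have hone : (1 : ℝ) ≤ n := by exact_mod_cast hn
  calc (1 / 4 : ℝ) ^ ⌈2 * logb 2 n⌉₊ ≤ (1 / 2) ^ ⌈2 * logb 2 n⌉₊ := by gcongr; norm_num
    _ = 1 / 2 ^ ⌈2 * logb 2 n⌉₊ := one_div_pow _ _
    _ ≤ 1 / (n : ℝ) ^ 2 := by gcongr; exact sq_le_two_pow_ceil_logb hn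
    _ ≤ 1 / n := by gcongr; exact le_self_pow₀ hone two_ne_zero

/-- The event on which the recovery of `S` succeeds for most vertices of `S`. -/
def goodEvent (S : Finset (Fin n)) : Set (SimpleGraph (Fin n)) :=
  {H | IsPseudorandom H S (2 * logb 2 n) ∧ ‖crossSign H S‖ ≤ 16 * √n}

theorem nonempty_of_rpow_le (hn : 1 ≤ n) (hk : 100 * (n : ℝ) ^ (2 / 3 : ℝ) ≤ #S) :
    S.Nonempty := by
  have hpos : (0 : ℝ) < (n : ℝ) ^ (2 / 3 : ℝ) := rpow_pos_of_pos (by exact_mod_cast hn) _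
  exact card_pos.1 (by exact_mod_cast (by linarith : (0 : ℝ) < #S))

theorem randomGraph_real_compl_goodEvent_le (hn : 1 ≤ n)
    (hk : 100 * (n : ℝ) ^ (2 / 3 : ℝ) ≤ #S) : (randomGraph S).real (goodEvent S)ᶜ ≤ 8 / n := by
  have hpseudo := randomGraph_real_not_isPseudorandom_le (nonempty_of_rpow_le hn hk)
    (sq_le_two_pow_ceil_logb hn)
  have hnorm := randomGraph_real_lt_norm_crossSign_le (S := S) (t := 16 * √n) (by positivity)
  have hcompl : (goodEvent S)ᶜ =
      {H | ¬ IsPseudorandom H S (2 * logb 2 n)} ∪ {H | 16 * √n < ‖crossSign H S‖} := by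
    ext H
    simp only [goodEvent, Set.mem_compl_iff, Set.mem_ofPred_eq, not_and_or, not_le, Set.mem_union]
  calc (randomGraph S).real (goodEvent S)ᶜ
      ≤ n * exp (-(#S / 18)) + (1 / 4) ^ ⌈2 * logb 2 n⌉₊ +
          5 ^ n * exp (-(16 * √n) ^ 2 / 32) := by
        rw [hcompl]
        exact (measureReal_union_le _ _).trans (add_le_add hpseudo hnorm)
    _ ≤ 6 / n + 1 / n + 1 / n := by
        gcongr
        exacts [mul_exp_neg_le hn hk, one_fourth_pow_ceil_logb_le hn, five_pow_mul_exp_le hn]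
    _ = 8 / n := by ring

end FailureProbabilities

section Recovery

open scoped Matrix.Norms.L2Operator

variable {n : ℕ} {S : Finset (Fin n)}

theorem prod_real_le {α β : Type*} [MeasurableSpace α] [MeasurableSpace β] {μ : Measure α}
    {ν : Measure β} [IsProbabilityMeasure μ] [IsProbabilityMeasure ν] {Q : Set (α × β)}
    (hQ : MeasurableSet Q) {s : Set α} {ε : ℝ} (hε : 0 ≤ ε)
    (hs : ∀ a ∈ s, ν.real (Prod.mk a ⁻¹' Q) ≤ ε) : (μ.prod ν).real Q ≤ μ.real sᶜ + ε := by
  refine ENNReal.toReal_le_of_le_ofReal (by positivity) ?_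
  have hsection : ∀ a, ν (Prod.mk a ⁻¹' Q) ≤ sᶜ.indicator 1 a + ENNReal.ofReal ε := fun a => by
    by_cases ha : a ∈ s
    · refine le_add_left ?_
      rw [← ofReal_measureReal]
      exact ENNReal.ofReal_le_ofReal (hs a ha)
    · refine le_add_right ?_
      rw [Set.indicator_of_mem (Set.mem_compl ha)]
      exact prob_le_one
  calc (μ.prod ν) Q = ∫⁻ a, ν (Prod.mk a ⁻¹' Q) ∂μ := Measure.prod_apply hQ
    _ ≤ ∫⁻ a, (sᶜ.indicator 1 a + ENNReal.ofReal ε) ∂μ := lintegral_mono hsection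
    _ ≤ μ sᶜ + ENNReal.ofReal ε := by
        rw [lintegral_add_right _ measurable_const, lintegral_const, measure_univ, mul_one]
        gcongr
        exact lintegral_indicator_one_le _
    _ = ENNReal.ofReal (μ.real sᶜ + ε) := by
        rw [ENNReal.ofReal_add measureReal_nonneg hε, ofReal_measureReal]

theorem uniformOn_real_apply {α : Type*} [MeasurableSpace α] [MeasurableSingletonClass α]
    [Finite α] (s : Finset α) (p : α → Prop) [DecidablePred p] :
    (uniformOn (s : Set α)).real {a | p a} = #{a ∈ s | p a} / #s := by
  classical
  cases nonempty_fintype α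
  have hset : {a | p a} = (({a | p a} : Finset α) : Set α) := by simp
  rw [hset, measureReal_def, uniformOn_apply_finset, inter_filter, inter_univ, ENNReal.toReal_div,
    ENNReal.toReal_natCast, ENNReal.toReal_natCast]

theorem mem_removeSmall_candidateList {G H : SimpleGraph (Fin n)} {x : VectorAssignment n}
    (hn : 1 ≤ n) (hk : 100 * (n : ℝ) ^ (2 / 3 : ℝ) ≤ #S) (hH : H ∈ goodEvent S) (hHG : H ≤ G)
    (hG : IsPseudorandom G S (2 * logb 2 n)) (hx : IsOptimal G x) :
    S ∈ removeSmall (candidateList G x) := by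
  refine mem_removeSmall.2 ⟨hx.mem_candidateList hG hHG (nonempty_of_rpow_le hn hk) ?_, ?_⟩
  · set a : ℝ := (n : ℝ) ^ (1 / 3 : ℝ) with ha
    have ha0 : 0 ≤ a := by positivity
    rw [rpow_two_thirds_eq_sq, ← ha] at hk
    have hroot : 10 * a ≤ √(#S) := le_sqrt_of_sq_le (by linarith)
    calc 48 * (‖crossSign H S‖ * (√(#S) * √n)) ≤ 48 * (16 * √n * (√(#S) * √n)) := by
          gcongr
          exact hH.2
      _ = 768 * a ^ 3 * √(#S) := by
          rw [rpow_one_third_pow_three]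
          nth_rw 3 [← mul_self_sqrt (Nat.cast_nonneg n)]
          ring
      _ ≤ (10 * a) ^ 3 * √(#S) := by
          rw [mul_pow]
          gcongr
          norm_num
      _ ≤ √(#S) ^ 3 * √(#S) := by gcongr
      _ = #S ^ 2 := by
          nth_rw 3 [← sq_sqrt (Nat.cast_nonneg #S)]
          ring
  · exact (le_mul_of_one_le_left (by positivity) (by norm_num)).trans hk

theorem one_sub_le_inputLaw_real_recover_eq_some {A : SimpleGraph (Fin n) → SimpleGraph (Fin n)}
    (hA : IsAdversary S A) {x : SimpleGraph (Fin n) → VectorAssignment n}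
    (hx : ∀ H, IsOptimal (A H) (x H)) (hn : 1 ≤ n) (hk : 100 * (n : ℝ) ^ (2 / 3 : ℝ) ≤ #S)
    (hlog : 6 * logb 2 n ≤ (n : ℝ) ^ (1 / 3 : ℝ)) :
    1 - (8 / n + logb 2 n / (n : ℝ) ^ (1 / 3 : ℝ)) ≤
      (inputLaw S).real {p | recover (A p.1) (x p.1) p.2 = some S} := by
  classical
  have hlog0 := logb_two_natCast_nonneg n
  have ha1 := one_le_rpow_one_third hn
  have hne := nonempty_of_rpow_le hn hk
  have hprob := isProbabilityMeasure_uniformOn (Ω := Fin n) S.finite_toSet (coe_nonempty.2 hne)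
  have hsection : ∀ H ∈ goodEvent S,
      (uniformOn (S : Set (Fin n))).real {u | recover (A H) (x H) u ≠ some S} ≤
        logb 2 n / (n : ℝ) ^ (1 / 3 : ℝ) := fun H hH => by
    have hpseudo := hH.1.of_le (hA H).1 (hA H).2
    have hcount := card_recover_ne_le hpseudo hn hlog
      (mem_removeSmall_candidateList hn hk hH (hA H).1 hpseudo (hx H))
    rw [rpow_two_thirds_eq_sq] at hk
    set a := (n : ℝ) ^ (1 / 3 : ℝ)
    rw [uniformOn_real_apply]
    calc _ ≤ 4 * a * logb 2 n / (100 * a ^ 2) := by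
          gcongr
      _ = logb 2 n / (25 * a) := by field_simp; ring
      _ ≤ logb 2 n / a := by gcongr; linarith
  have hfail := (prod_real_le (μ := randomGraph S)
    (Q := {p | recover (A p.1) (x p.1) p.2 = some S}ᶜ) .of_discrete (by positivity) hsection).trans
    (add_le_add_left (randomGraph_real_compl_goodEvent_le hn hk) _)
  rw [probReal_compl_eq_one_sub .of_discrete] at hfail
  rw [inputLaw]
  linarith

theorem tendsto_logb_div_rpow_one_third :
    Filter.Tendsto (fun n : ℕ => logb 2 n / (n : ℝ) ^ (1 / 3 : ℝ)) Filter.atTop (nhds 0) := by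
  have hlog := ((isLittleO_log_rpow_atTop (r := 1 / 3) (by norm_num)).tendsto_div_nhds_zero.comp
    tendsto_natCast_atTop_atTop).div_const (log 2)
  rw [zero_div] at hlog
  exact hlog.congr fun n => by rw [Function.comp_apply, logb, div_right_comm]

end Recovery

end SemirandomIndepSet

theorem theorem2 :
    ∃ c₁ : ℝ, 0 < c₁ ∧ ∀ δ : ℝ, 0 < δ → ∃ N : ℕ, ∀ n : ℕ, N ≤ n → ∀ k : ℕ,
      c₁ * (n : ℝ) ^ (2 / 3 : ℝ) ≤ (k : ℝ) →
      ∀ S : Finset (Fin n), S.card = k →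
      ∀ A : SimpleGraph (Fin n) → SimpleGraph (Fin n), SemirandomIndepSet.IsAdversary S A →
      ∀ sol : SimpleGraph (Fin n) → SemirandomIndepSet.VectorAssignment n,
        (∀ G, SemirandomIndepSet.IsOptimal G (sol G)) →
        1 - δ ≤ (SemirandomIndepSet.inputLaw S).real
          {p | SemirandomIndepSet.recover (A p.1) (sol (A p.1)) p.2 = some S} := by
  refine ⟨100, by norm_num, fun δ hδ => ?_⟩
  have hlog := SemirandomIndepSet.tendsto_logb_div_rpow_one_third
  have hfail : Filter.Tendsto
      (fun n : ℕ => 8 / (n : ℝ) + Real.logb 2 n / (n : ℝ) ^ (1 / 3 : ℝ)) Filter.atTop (nhds 0) := by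
    simpa using (tendsto_const_div_atTop_nhds_zero_nat 8).add hlog
  have hlarge := (Filter.eventually_ge_atTop 1).and
    ((hlog.eventually_le_const (by norm_num : (0 : ℝ) < 1 / 6)).and (hfail.eventually_le_const hδ))
  obtain ⟨N, hN⟩ := Filter.eventually_atTop.1 hlarge
  refine ⟨N, fun n hn k hk S hS A hA sol hsol => ?_⟩
  subst hS
  obtain ⟨hn1, hlog6, hδn⟩ := hN n hn
  have ha := SemirandomIndepSet.one_le_rpow_one_third hn1
  rw [div_le_iff₀ (by linarith)] at hlog6
  exact (sub_le_sub_left hδn 1).trans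
    (SemirandomIndepSet.one_sub_le_inputLaw_real_recover_eq_some (x := fun H => sol (A H)) hA
      (fun H => hsol (A H)) hn1 hk (by linarith))
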